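/- Let $(Y(u))_{u\in(0,\infty)}$ be a real-valued stochastic process on a probability space $(\Omega,\mathcal F,\mathbb P)$ that is centred, in the sense that $\mathbb E[Y(u)]=0$ for every $u>0$ for which $Y(u)$ is integrable (integrability of $Y(u)$ itself is not assumed). For $u>0$ write $\mathcal F_u^+:=\sigma(Y(s):s\ge u)$ and $\mathcal F_u^-:=\sigma(Y(s):0<s\le u)$, and for $0<s<r$ let $\mathcal F_{s,r}$ be the $\sigma$-algebra generated by $\mathcal F_s^-$ and $\mathcal F_r^+$. Suppose that: (i) $Y$ is stochastically continuous: for every $u_0\in(0,\infty)$, $Y(u)\to Y(u_0)$ in probability as $u\to u_0$; (ii) for some $\xi>0$, $\mathbb E[|Y(u)|^\xi]<\infty$ for all $u\in(0,\infty)$; (iii) $Y$ satisfies Brownian scaling: for every $c>0$, the processes $(Y(cu))_{u>0}$ and $(\sqrt c\,Y(u))_{u>0}$ have the same law; (iv) for every $u>0$, the process $(Y(s)-Y(u))_{s\ge u}$ is independent of $\mathcal F_u^-$; (v) for all $0<s<r$, the process $$\Bigl(Y(u)-\Bigl(\tfrac{u-s}{r-s}Y(r)+\tfrac{r-u}{r-s}Y(s)\Bigr)\Bigr)_{u\in(s,r)}$$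 is independent of $\mathcal F_{s,r}$. Then there exist $\sigma\ge 0$ and a modification $Z$ of $Y$ (that is, $\mathbb P(Z(u)=Y(u))=1$ for every $u>0$), all of whose paths are continuous on $(0,\infty)$, such that $(Z(u))_{u>0}$ is equal in law to $(\sigma B(u))_{u>0}$, where $B=(B(t))_{t\ge0}$ is a standard one-dimensional Brownian motion. -/

import Mathlib

open MeasureTheory ProbabilityTheory Filter Topology
open scoped NNReal

/-- The index set `(0, ∞)`. -/
abbrev PosTime : Type := Set.Ioi (0 : ℝ)

/-- The dilated time `c * u`, for `c > 0`. -/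
def PosTime.scale (c u : PosTime) : PosTime := ⟨(c : ℝ) * (u : ℝ), Set.mem_Ioi.2 (mul_pos c.2 u.2)⟩

/-- A positive time, seen as a nonnegative real. -/
def PosTime.toNNReal (u : PosTime) : ℝ≥0 := ⟨(u : ℝ), le_of_lt u.2⟩

/-- The past `ℱ_u⁻ = σ(Y s : s ≤ u)`. -/
abbrev pastSigma {Ω : Type*} (Y : PosTime → Ω → ℝ) (u : PosTime) : MeasurableSpace Ω :=
  ⨆ s : Set.Iic u, MeasurableSpace.comap (Y s) inferInstance

/-- The future `ℱ_u⁺ = σ(Y s : s ≥ u)`. -/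
abbrev futureSigma {Ω : Type*} (Y : PosTime → Ω → ℝ) (u : PosTime) : MeasurableSpace Ω :=
  ⨆ s : Set.Ici u, MeasurableSpace.comap (Y s) inferInstance

/-- The outside `σ`-algebra `ℱ_{s,r}`, generated by `ℱ_s⁻` and `ℱ_r⁺`. -/
abbrev outsideSigma {Ω : Type*} (Y : PosTime → Ω → ℝ) (s r : PosTime) : MeasurableSpace Ω :=
  pastSigma Y s ⊔ futureSigma Y r

/-- Centred: every `Y u` which has an expectation has expectation zero. The integrability of
`Y u` is not part of this condition. -/
def IsCentred {Ω : Type*} [MeasurableSpace Ω] (Y : PosTime → Ω → ℝ) (P : Measure Ω) : Prop :=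
  ∀ u, Integrable (Y u) P → ∫ ω, Y u ω ∂P = 0

/-- Stochastic continuity: `Y u → Y u₀` in probability as `u → u₀`, for every `u₀ > 0`. -/
def IsStochasticallyContinuous {Ω : Type*} [MeasurableSpace Ω] (Y : PosTime → Ω → ℝ)
    (P : Measure Ω) : Prop :=
  ∀ u₀, TendstoInMeasure P Y (𝓝 u₀) (Y u₀)

/-- Brownian scaling: `(Y (c u))_{u > 0}` and `(√c Y u)_{u > 0}` have the same law, as random
elements of the space of functions on `(0, ∞)` with its product `σ`-algebra. -/
def HasBrownianScaling {Ω : Type*} [MeasurableSpace Ω] (Y : PosTime → Ω → ℝ)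
    (P : Measure Ω) : Prop :=
  ∀ c : PosTime, IdentDistrib (fun ω (u : PosTime) => Y (c.scale u) ω)
    (fun ω (u : PosTime) => √(c : ℝ) * Y u ω) P P

/-- For every `u > 0` the process `(Y s - Y u)_{s ≥ u}` is independent of `ℱ_u⁻`. -/
def HasIndepForwardIncrements {Ω : Type*} [MeasurableSpace Ω] (Y : PosTime → Ω → ℝ)
    (P : Measure Ω) : Prop :=
  ∀ u : PosTime, Indep
    (MeasurableSpace.comap (fun ω (s : Set.Ici u) => Y s ω - Y u ω) MeasurableSpace.pi)
    (pastSigma Y u) P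

/-- The deviation at time `u` of `Y` from its linear interpolation between times `s` and `r`. -/
noncomputable def bridge {Ω : Type*} (Y : PosTime → Ω → ℝ) (s r u : PosTime) (ω : Ω) : ℝ :=
  Y u ω - (((u : ℝ) - s) / ((r : ℝ) - s) * Y r ω + ((r : ℝ) - u) / ((r : ℝ) - s) * Y s ω)

/-- The harness property: for `0 < s < r`, the process of the deviations from the linear
interpolation between `s` and `r`, indexed by `(s, r)`, is independent of `ℱ_{s,r}`. -/
def HasHarnessProperty {Ω : Type*} [MeasurableSpace Ω] (Y : PosTime → Ω → ℝ)
    (P : Measure Ω) : Prop :=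
  ∀ s r : PosTime, s < r → Indep
    (MeasurableSpace.comap (fun ω (u : Set.Ioo s r) => bridge Y s r u ω) MeasurableSpace.pi)
    (outsideSigma Y s r) P

/-! Put `A = Y 1` and `B = Y 2 - Y 1`; these are independent because the increments are. The bridge
over `(s, 2)` at time `1` is independent of `Y 2`. As `s → 0`, scaling sends `Y s` to `0` in
probability, so in the limit `2 * Y 1 - Y 2 = A - B` is independent of `Y 2 = A + B`. Bernstein's
theorem (`exists_hasLaw_gaussianReal_of_bernstein`) then makes `Y 1` normal. A normal variable is
integrable, so centring gives it mean zero, and scaling yields the law of every `Y u`.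

Independent increments with these marginals make `σ⁻¹ Y` a pre-Brownian motion when `σ ≠ 0`. Its
continuous modification comes from a Borel–Cantelli argument along dyadics
(`exists_continuous_modification`). The comparison motion `B` is built from an isonormal process,
and the two laws agree because their finite-dimensional marginals do. -/

/-! ### Functional equations for characteristic functions. -/

/-- A continuous solution of the quadratic functional equation is a multiple of the square. -/
lemma eq_mul_sq_of_quadratic {g : ℝ → ℝ} (hg : Continuous g)
    (h : ∀ s t, g (s + t) + g (s - t) = 2 * g s + 2 * g t) (s : ℝ) : g s = g 1 * s ^ 2 := by
  have h0 : g 0 = 0 := by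
    have := h 0 0
    simp only [add_zero, sub_zero] at this
    linarith
  have heven : ∀ t, g (-t) = g t := fun t => by
    have := h 0 t
    simp only [zero_add, zero_sub, h0] at this
    linarith
  -- Two consecutive values are carried along because the equation is a two-step recurrence in `n`.
  have hnat : ∀ (n : ℕ) (t : ℝ), g (n * t) = n ^ 2 * g t ∧ g ((n + 1) * t) = (n + 1) ^ 2 * g t := by
    intro n t
    induction n with
    | zero => simp [h0]
    | succ n ih =>
      refine ⟨by simpa using ih.2, ?_⟩
      have := h ((n + 1) * t) t
      rw [show (n + 1 : ℝ) * t + t = ((n + 1 : ℕ) + 1) * t by push_cast; ring,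
        show (n + 1 : ℝ) * t - t = n * t by ring, ih.1, ih.2] at this
      push_cast at this ⊢
      linarith
  have hint : ∀ (n : ℤ) (t : ℝ), g (n * t) = n ^ 2 * g t := by
    intro n t
    obtain ⟨k, rfl | rfl⟩ := n.eq_nat_or_neg
    · simpa using (hnat k t).1
    · have := (hnat k t).1
      push_cast
      rw [neg_mul, heven, this]
      ring
  have key : g = fun s => g 1 * s ^ 2 := by
    refine Rat.isDenseEmbedding_coe_real.dense.equalizer hg (by fun_prop) ?_
    funext q
    have hq : (q.den : ℝ) ≠ 0 := by exact_mod_cast q.den_ne_zero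
    have h1 : g ((q.den : ℤ) * (q : ℝ)) = g ((q.num : ℤ) * (1 : ℝ)) := by
      congr 1
      rw [mul_one]
      exact_mod_cast Rat.den_mul_eq_num q
    rw [hint, hint] at h1
    have h2 : (q : ℝ) = q.num / q.den := by exact_mod_cast (Rat.num_div_den q).symm
    simp only [Function.comp_apply]
    push_cast at h1
    nth_rw 2 [h2]
    field_simp
    linarith
  exact congrFun key s

/-- A continuous unitary character of the real line is an exponential. -/
lemma exists_eq_exp_of_character {e : ℝ → ℂ} (he : Continuous e) (hnorm : ∀ s, ‖e s‖ = 1)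
    (hadd : ∀ s t, e (s + t) = e s * e t) :
    ∃ m : ℝ, ∀ s : ℝ, e s = Complex.exp (m * s * Complex.I) := by
  have hne : ∀ s, e s ≠ 0 := fun s hs => by simpa [hs] using hnorm s
  have h0 : e 0 = 1 := by
    have := hadd 0 0
    rw [add_zero] at this
    exact (mul_eq_left₀ (hne 0)).1 this.symm
  -- Integrating `e (s + t) = e s * e t` over `t` from `0` to `δ` writes `e` through its primitive,
  -- so `e` is differentiable. A suitable `δ` exists because `Φ` has derivative `e 0 ≠ 0` at `0`.
  set Φ : ℝ → ℂ := fun x => ∫ t in (0 : ℝ)..x, e t with hΦ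
  have hΦd : ∀ x, HasDerivAt Φ (e x) x := fun x =>
    intervalIntegral.integral_hasDerivAt_right (he.intervalIntegrable _ _)
      (he.stronglyMeasurableAtFilter _ _) he.continuousAt
  obtain ⟨δ, hδ⟩ : ∃ δ, Φ δ ≠ 0 := by
    by_contra! hall
    have h1 := hΦd 0
    rw [funext hall] at h1
    have := h1.unique (hasDerivAt_const 0 0)
    exact hne 0 this
  have hrep : ∀ s, e s = (Φ δ)⁻¹ * (Φ (s + δ) - Φ s) := by
    intro s
    have h1 : Φ (s + δ) - Φ s = ∫ t in s..(s + δ), e t :=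
      intervalIntegral.integral_interval_sub_left (he.intervalIntegrable _ _)
        (he.intervalIntegrable _ _)
    have h2 : ∫ t in s..(s + δ), e t = e s * Φ δ := by
      rw [hΦ, ← intervalIntegral.integral_const_mul]
      simp_rw [← hadd]
      rw [intervalIntegral.integral_comp_add_left]
      simp
    rw [h1, h2]
    field_simp
  set a : ℂ := (Φ δ)⁻¹ * (e δ - 1) with ha
  have hder : ∀ s, HasDerivAt e (a * e s) s := by
    intro s
    have h1 : HasDerivAt (fun s => (Φ δ)⁻¹ * (Φ (s + δ) - Φ s))
        ((Φ δ)⁻¹ * (e (s + δ) - e s)) s :=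
      (((hΦd (s + δ)).comp_add_const s δ).sub (hΦd s)).const_mul _
    rw [show (fun s => (Φ δ)⁻¹ * (Φ (s + δ) - Φ s)) = e from (funext hrep).symm] at h1
    convert h1 using 1
    rw [ha, hadd]
    ring
  have hexp : ∀ s : ℝ, e s = Complex.exp (a * s) := by
    have hd : ∀ s : ℝ, HasDerivAt (fun s : ℝ => e s * Complex.exp (-(a * s))) 0 s := by
      intro s
      have h1 : HasDerivAt (fun s : ℝ => Complex.exp (-(a * s)))
          (Complex.exp (-(a * s)) * (-(a * 1))) s :=
        ((Complex.ofRealCLM.hasDerivAt (x := s)).const_mul a).neg.cexp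
      refine ((hder s).mul h1).congr_deriv ?_
      ring
    intro s
    have h1 := is_const_of_deriv_eq_zero (fun s => (hd s).differentiableAt)
      (fun s => (hd s).deriv) s 0
    simp only [Complex.ofReal_zero, mul_zero, neg_zero, Complex.exp_zero, mul_one, h0] at h1
    rw [Complex.exp_neg] at h1
    have := Complex.exp_ne_zero (a * s)
    field_simp at h1
    exact h1
  have hre : a.re = 0 := by
    have h1 := hnorm 1
    rw [hexp, Complex.norm_exp] at h1
    simpa using h1
  refine ⟨a.im, fun s => ?_⟩
  rw [hexp]
  congr 1
  apply Complex.ext <;> simp [hre]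

/-- The functional equation behind Bernstein's characterization of the normal law. -/
lemma exists_eq_exp_of_bernstein {φ ψ : ℝ → ℂ} (hφ : Continuous φ)
    (hφ0 : φ 0 = 1) (hψ0 : ψ 0 = 1) (hφn : ∀ s, φ (-s) = starRingEnd ℂ (φ s))
    (hψn : ∀ s, ψ (-s) = starRingEnd ℂ (ψ s)) (hφ1 : ∀ s, ‖φ s‖ ≤ 1)
    (h : ∀ s t, φ (s + t) * ψ (s - t) = φ s * ψ s * (φ t * ψ (-t))) :
    ∃ m c : ℝ, 0 ≤ c ∧ ∀ s : ℝ, φ s = Complex.exp (m * s * Complex.I - c * s ^ 2) := by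
  have hnφ : ∀ s, ‖φ (-s)‖ = ‖φ s‖ := fun s => by rw [hφn, Complex.norm_conj]
  have hnψ : ∀ s, ‖ψ (-s)‖ = ‖ψ s‖ := fun s => by rw [hψn, Complex.norm_conj]
  have hn : ∀ s t, ‖φ (s + t)‖ * ‖ψ (s - t)‖ = ‖φ s‖ * ‖ψ s‖ * (‖φ t‖ * ‖ψ t‖) := fun s t => by
    rw [← hnψ t, ← norm_mul, ← norm_mul, ← norm_mul, ← norm_mul, h]
  -- At `(s/2, s/2)` and `(s/2, -s/2)` the right side of `hn` is the same, while the left side is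
  -- `‖φ s‖` and `‖ψ s‖` respectively.
  have heq : ∀ s, ‖ψ s‖ = ‖φ s‖ := by
    intro s
    have h1 := hn (s / 2) (s / 2)
    have h2 := hn (s / 2) (-(s / 2))
    simp only [add_halves, sub_self, hψ0, norm_one, mul_one, add_neg_cancel, hφ0, one_mul,
      sub_neg_eq_add, hnφ, hnψ] at h1 h2
    rw [h1, h2]
  have hquad : ∀ s t, ‖φ (s + t)‖ * ‖φ (s - t)‖ = ‖φ s‖ ^ 2 * ‖φ t‖ ^ 2 := fun s t => by
    have := hn s t
    simp only [heq] at this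
    linarith
  -- By `hquad` a zero at `s` forces zeros at all `s / 2 ^ n`, against continuity and `φ 0 = 1`.
  have hne : ∀ s, φ s ≠ 0 := by
    intro s hs
    have hz : ∀ n : ℕ, φ (s / 2 ^ n) = 0 := by
      intro n
      induction n with
      | zero => simpa using hs
      | succ n ih =>
        have h1 := hquad (s / 2 ^ (n + 1)) (s / 2 ^ (n + 1))
        rw [show s / 2 ^ (n + 1) + s / 2 ^ (n + 1) = s / 2 ^ n by rw [pow_succ]; ring, ih,
          norm_zero, zero_mul] at h1
        have : ‖φ (s / 2 ^ (n + 1))‖ ^ 4 = 0 := by linarith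
        simpa using this
    have hlim : Tendsto (fun n : ℕ => φ (s / 2 ^ n)) atTop (𝓝 (φ 0)) := by
      refine (hφ.tendsto 0).comp ?_
      have := (tendsto_pow_atTop_nhds_zero_of_lt_one (r := (1 / 2 : ℝ)) (by norm_num)
        (by norm_num)).const_mul s
      simpa [div_eq_mul_inv] using this
    simp only [hz, hφ0] at hlim
    exact zero_ne_one (tendsto_nhds_unique tendsto_const_nhds hlim)
  have hpos : ∀ s, 0 < ‖φ s‖ := fun s => norm_pos_iff.2 (hne s)
  set c : ℝ := -Real.log ‖φ 1‖ with hc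
  have hmod : ∀ s, ‖φ s‖ = Real.exp (-c * s ^ 2) := by
    intro s
    have h1 := eq_mul_sq_of_quadratic (g := fun s => Real.log ‖φ s‖)
      (hφ.norm.log fun s => (hpos s).ne') (fun s t => by
        rw [← Real.log_mul (hpos _).ne' (hpos _).ne', hquad,
          Real.log_mul (pow_pos (hpos _) 2).ne' (pow_pos (hpos _) 2).ne', Real.log_pow,
          Real.log_pow]
        push_cast
        ring) s
    rw [hc, neg_neg, ← h1, Real.exp_log (hpos s)]
  have hcn : (∀ s, ((‖φ s‖ : ℝ) : ℂ) ≠ 0) := fun s => by exact_mod_cast (hpos s).ne'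
  -- The modulus is settled; `e` and `d` are the phases of `φ` and `ψ`.
  set e : ℝ → ℂ := fun s => φ s / ‖φ s‖ with he
  set d : ℝ → ℂ := fun s => ψ s / ‖φ s‖ with hd
  have hed : ∀ s t, e (s + t) * d (s - t) = e s * d s * (e t * d (-t)) := by
    intro s t
    have h1 := h s t
    have h2 : ((‖φ (s + t)‖ : ℝ) : ℂ) * (‖φ (s - t)‖ : ℝ) = (‖φ s‖ : ℝ) ^ 2 * (‖φ t‖ : ℝ) ^ 2 := by
      exact_mod_cast hquad s t
    simp only [he, hd, hnφ]
    rw [div_mul_div_comm, h1, h2]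
    field_simp
  have hdd : ∀ s, d s * d (-s) = 1 := by
    intro s
    simp only [hd, hnφ, hψn]
    rw [div_mul_div_comm, Complex.mul_conj, Complex.normSq_eq_norm_sq, heq, ← pow_two]
    push_cast
    exact div_self (pow_ne_zero 2 (hcn s))
  have he2 : ∀ s, e (s + s) = e s ^ 2 := by
    intro s
    have h1 := hed s s
    have h2 : d 0 = 1 := by simp [hd, hψ0, hφ0]
    rw [sub_self, h2, mul_one] at h1
    rw [h1]
    linear_combination (e s) ^ 2 * hdd s
  -- Multiplying the equations at `(s, t)` and `(t, s)` cancels every factor `d`. The squares are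
  -- removed below by halving the arguments and using `he2`, so no sign of a root has to be chosen.
  have hsq : ∀ s t, e (s + t) ^ 2 = e s ^ 2 * e t ^ 2 := by
    intro s t
    have h1 := hed s t
    have h2 := hed t s
    have h3 := hdd (s - t)
    rw [add_comm t s] at h2
    rw [neg_sub] at h3
    calc e (s + t) ^ 2 = (e (s + t) * d (s - t)) * (e (s + t) * d (t - s)) := by
          linear_combination -(e (s + t) ^ 2) * h3
      _ = e s ^ 2 * e t ^ 2 * ((d s * d (-s)) * (d t * d (-t))) := by rw [h1, h2]; ring
      _ = _ := by rw [hdd, hdd]; ring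
  obtain ⟨m, hm⟩ := exists_eq_exp_of_character (e := e)
    (hφ.div (Complex.continuous_ofReal.comp hφ.norm) hcn)
    (fun s => by simp [he, (hpos s).ne'])
    (fun s t => by
      have h1 := hsq (s / 2) (t / 2)
      rw [← he2, ← he2, ← he2, add_halves, add_halves] at h1
      rw [← h1]
      congr 1
      ring)
  refine ⟨m, c, ?_, fun s => ?_⟩
  · rw [hc, neg_nonneg]
    exact Real.log_nonpos (norm_nonneg _) (hφ1 1)
  · rw [sub_eq_add_neg, Complex.exp_add, ← hm]
    have : Complex.exp (-((c : ℂ) * (s : ℂ) ^ 2)) = ((‖φ s‖ : ℝ) : ℂ) := by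
      rw [hmod]
      push_cast
      congr 1
      ring
    rw [this, he]
    exact (div_mul_cancel₀ _ (hcn s)).symm

/-! ### Bernstein's theorem for random variables. -/

/-- Independence from a fixed random variable passes to almost sure limits. -/
lemma indepFun_of_tendsto_ae {Ω : Type*} [MeasurableSpace Ω] {P : Measure Ω}
    [IsProbabilityMeasure P] {X : ℕ → Ω → ℝ} {X' Y : Ω → ℝ} (hX : ∀ n, Measurable (X n))
    (hX' : Measurable X') (hY : Measurable Y) (hind : ∀ n, IndepFun (X n) Y P)
    (hlim : ∀ᵐ ω ∂P, Tendsto (fun n => X n ω) atTop (𝓝 (X' ω))) : IndepFun X' Y P := by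
  -- Independence is a factorization of characteristic functions, which survives almost sure limits
  -- by dominated convergence.
  rw [indepFun_iff_charFun_prod hX'.aemeasurable hY.aemeasurable]
  intro t
  have h1 : ∀ {Z : Ω → ℝ}, Measurable Z → ∀ s, charFun (P.map Z) s
      = ∫ ω, Complex.exp (s * Z ω * Complex.I) ∂P := fun {Z} hZ s => by
    rw [charFun_apply_real, integral_map hZ.aemeasurable (by fun_prop)]
  have h2 : ∀ {Z : Ω → ℝ}, Measurable Z →
      charFun (P.map fun ω => WithLp.toLp 2 (Z ω, Y ω)) t
      = ∫ ω, Complex.exp ((t.fst * Z ω + t.snd * Y ω : ℝ) * Complex.I) ∂P := fun {Z} hZ => by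
    rw [charFun_apply, integral_map (by fun_prop) (by fun_prop)]
    refine integral_congr_ae (.of_forall fun ω => ?_)
    simp [WithLp.prod_inner_apply]
  have hl1 : Tendsto (fun n => charFun (P.map (X n)) t.fst) atTop
      (𝓝 (charFun (P.map X') t.fst)) := by
    simp_rw [h1 (hX _), h1 hX']
    refine tendsto_integral_of_dominated_convergence (fun _ => 1) (fun n => by fun_prop)
      (integrable_const _) (fun n => .of_forall fun ω => ?_) ?_
    · rw [← Complex.ofReal_mul, Complex.norm_exp_ofReal_mul_I]
    · filter_upwards [hlim] with ω hω
      exact (Complex.continuous_exp.tendsto _).comp (((Complex.continuous_ofReal.tendsto _).comp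
        hω).const_mul _ |>.mul_const _)
  have hl2 : Tendsto (fun n => charFun (P.map fun ω => WithLp.toLp 2 (X n ω, Y ω)) t) atTop
      (𝓝 (charFun (P.map fun ω => WithLp.toLp 2 (X' ω, Y ω)) t)) := by
    simp_rw [h2 (hX _), h2 hX']
    refine tendsto_integral_of_dominated_convergence (fun _ => 1) (fun n => by fun_prop)
      (integrable_const _) (fun n => .of_forall fun ω => ?_) ?_
    · rw [Complex.norm_exp_ofReal_mul_I]
    · filter_upwards [hlim] with ω hω
      exact (Complex.continuous_exp.tendsto _).comp (((Complex.continuous_ofReal.tendsto _).comp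
        ((hω.const_mul _).add_const _)).mul_const _)
  refine tendsto_nhds_unique hl2 ?_
  have h3 := fun n => (indepFun_iff_charFun_prod (hX n).aemeasurable hY.aemeasurable).1 (hind n) t
  simp_rw [h3]
  exact hl1.mul_const _

/-- Bernstein's characterization of the normal law: if `A`, `B` are independent and so are
`A + B`, `A - B`, then `A` is normal. -/
theorem exists_hasLaw_gaussianReal_of_bernstein {Ω : Type*} [MeasurableSpace Ω] {P : Measure Ω}
    [IsProbabilityMeasure P] {A B : Ω → ℝ} (hA : Measurable A) (hB : Measurable B)
    (hAB : IndepFun A B P) (hsd : IndepFun (A + B) (A - B) P) :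
    ∃ (m : ℝ) (v : ℝ≥0), HasLaw A (gaussianReal m v) P := by
  have : IsProbabilityMeasure (P.map A) := Measure.isProbabilityMeasure_map hA.aemeasurable
  have : IsProbabilityMeasure (P.map B) := Measure.isProbabilityMeasure_map hB.aemeasurable
  have hchar : ∀ {Z : Ω → ℝ}, Measurable Z → ∀ s, charFun (P.map Z) s
      = ∫ ω, Complex.exp (s * Z ω * Complex.I) ∂P := fun {Z} hZ s => by
    rw [charFun_apply_real, integral_map hZ.aemeasurable (by fun_prop)]
  have hmul : ∀ {U V : Ω → ℝ}, Measurable U → Measurable V → IndepFun U V P → ∀ s t : ℝ,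
      ∫ ω, Complex.exp ((s * U ω + t * V ω) * Complex.I) ∂P
        = charFun (P.map U) s * charFun (P.map V) t := by
    intro U V hU hV h s t
    rw [hchar hU, hchar hV]
    have h1 := (h.comp (φ := fun x : ℝ => Complex.exp (s * x * Complex.I))
      (ψ := fun x : ℝ => Complex.exp (t * x * Complex.I))
      (by fun_prop) (by fun_prop)).integral_fun_mul_eq_mul_integral (by fun_prop) (by fun_prop)
    simp only [Function.comp_apply] at h1
    rw [← h1]
    refine integral_congr_ae (.of_forall fun ω => ?_)
    simp only
    rw [← Complex.exp_add]
    ring_nf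
  -- The functional equation comes from `(s + t) A + (s - t) B = s (A + B) + t (A - B)`, with the
  -- expectation of the exponential factored on each side.
  obtain ⟨m, c, hc, hmc⟩ := exists_eq_exp_of_bernstein (φ := charFun (P.map A))
    (ψ := charFun (P.map B)) continuous_charFun (by simp) (by simp) (fun s => charFun_neg s)
    (fun s => charFun_neg s) (fun s => norm_charFun_le_one s) (fun s t => by
      have h1 := hmul hA hB hAB (s + t) (s - t)
      have h2 := hmul (hA.add hB) (hA.sub hB) hsd s t
      have h3 := hmul hA hB hAB s s
      have h4 := hmul hA hB hAB t (-t)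
      have h5 : charFun (P.map (A + B)) s = charFun (P.map A) s * charFun (P.map B) s := by
        rw [← h3, hchar (hA.add hB)]
        refine integral_congr_ae (.of_forall fun ω => ?_)
        simp only [Pi.add_apply, Complex.ofReal_add]
        ring_nf
      have h6 : charFun (P.map (A - B)) t = charFun (P.map A) t * charFun (P.map B) (-t) := by
        rw [← h4, hchar (hA.sub hB)]
        refine integral_congr_ae (.of_forall fun ω => ?_)
        simp only [Pi.sub_apply, Complex.ofReal_sub, Complex.ofReal_neg]
        ring_nf
      rw [← h1, ← h5, ← h6, ← h2]
      refine integral_congr_ae (.of_forall fun ω => ?_)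
      simp only [Pi.sub_apply, Pi.add_apply, Complex.ofReal_sub, Complex.ofReal_add]
      ring_nf)
  refine ⟨m, Real.toNNReal (2 * c), hA.aemeasurable, Measure.ext_of_charFun ?_⟩
  funext s
  rw [hmc, charFun_gaussianReal]
  congr 1
  rw [Real.coe_toNNReal _ (by positivity)]
  push_cast
  ring

/-- A family in which each member is independent of the preceding ones is independent. -/
lemma iIndepFun_of_indep_past {Ω : Type*} {mΩ : MeasurableSpace Ω} {P : Measure Ω}
    [IsProbabilityMeasure P] {ι : Type*} [LinearOrder ι] {D : ι → Ω → ℝ}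
    (𝓕 : ι → MeasurableSpace Ω) (hD : ∀ j i, j < i → Measurable[𝓕 i] (D j))
    (hind : ∀ i, Indep (MeasurableSpace.comap (D i) inferInstance) (𝓕 i) P) :
    iIndepFun D P := by
  rw [iIndepFun_iff_measure_inter_preimage_eq_mul]
  intro S sets hS
  classical
  -- Peeling off the largest index leaves an event of its past.
  induction S using Finset.induction_on_max with
  | empty => simp
  | insert a s ha ih =>
    have hna : a ∉ s := fun h => lt_irrefl _ (ha a h)
    rw [Finset.prod_insert hna, Finset.set_biInter_insert,
      ← ih fun i hi => hS i (Finset.mem_insert_of_mem hi)]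
    refine (Indep_iff _ _ _).1 (hind a) _ _ ⟨_, hS a (Finset.mem_insert_self _ _), rfl⟩ ?_
    exact Finset.measurableSet_biInter _ fun i hi =>
      hD i a (ha i hi) (hS i (Finset.mem_insert_of_mem hi))

/-! ### Normality of the one-dimensional laws. -/

/-- The time one. -/
abbrev PosTime.one : PosTime := ⟨1, Set.mem_Ioi.2 one_pos⟩

lemma measurable_pastSigma {Ω : Type*} {Y : PosTime → Ω → ℝ} {s u : PosTime} (h : s ≤ u) : Measurable[pastSigma Y u] (Y s) :=
  (comap_measurable (Y s)).mono
    (le_iSup (fun r : Set.Iic u => MeasurableSpace.comap (Y r) inferInstance) ⟨s, h⟩) le_rfl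

section Harness

variable {Ω : Type*} [MeasurableSpace Ω] {P : Measure Ω} {Y : PosTime → Ω → ℝ}

lemma HasBrownianScaling.identDistrib_mul (h : HasBrownianScaling Y P) (u : PosTime) :
    IdentDistrib (Y u) (fun ω => √(u : ℝ) * Y PosTime.one ω) P P := by
  have h1 := (h u).comp (u := fun x : PosTime → ℝ => x PosTime.one) (measurable_pi_apply _)
  have h2 : u.scale PosTime.one = u := Subtype.ext (mul_one _)
  simpa only [Function.comp_def, h2] using h1

lemma HasIndepForwardIncrements.indep_sub (h : HasIndepForwardIncrements Y P) {u s : PosTime}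
    (hus : u ≤ s) :
    Indep (MeasurableSpace.comap (fun ω => Y s ω - Y u ω) inferInstance) (pastSigma Y u) P := by
  refine indep_of_indep_of_le_left (h u) (Measurable.comap_le ?_)
  exact (measurable_pi_apply (⟨s, hus⟩ : Set.Ici u)).comp
    (comap_measurable (fun ω (s : Set.Ici u) => Y s ω - Y u ω))

lemma HasHarnessProperty.indepFun_bridge (h : HasHarnessProperty Y P) {s u r : PosTime}
    (hsu : s < u) (hur : u < r) : IndepFun (bridge Y s r u) (Y r) P := by
  refine indep_of_indep_of_le_left (indep_of_indep_of_le_right (h s r (hsu.trans hur)) ?_) ?_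
  · exact le_sup_of_le_right
      (le_iSup (fun q : Set.Ici r => MeasurableSpace.comap (Y q) inferInstance) ⟨r, Set.mem_Ici.2 le_rfl⟩)
  · refine Measurable.comap_le ?_
    exact (measurable_pi_apply (⟨u, hsu, hur⟩ : Set.Ioo s r)).comp
      (comap_measurable (fun ω (u : Set.Ioo s r) => bridge Y s r u ω))

/-- `√s * Y 1` tends to `0` pointwise and has the law of `Y s`; convergence in measure to a constant
depends only on the laws. -/
lemma HasBrownianScaling.tendstoInMeasure_zero [IsProbabilityMeasure P]
    (h : HasBrownianScaling Y P) (hY : ∀ u, Measurable (Y u)) {s : ℕ → PosTime}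
    (hs : Tendsto (fun n => (s n : ℝ)) atTop (𝓝 0)) :
    TendstoInMeasure P (fun n => Y (s n)) atTop 0 := by
  have h1 : TendstoInMeasure P (fun n ω => √(s n : ℝ) * Y PosTime.one ω) atTop 0 := by
    refine tendstoInMeasure_of_tendsto_ae
      (fun n => ((hY _).const_mul _).aestronglyMeasurable) (.of_forall fun ω => ?_)
    have := ((Real.continuous_sqrt.tendsto 0).comp hs).mul_const (Y PosTime.one ω)
    simpa using this
  intro ε hε
  refine (h1 ε hε).congr fun n => ?_
  exact ((h.identDistrib_mul (s n)).measure_mem_eq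
    (s := {x : ℝ | ε ≤ edist x 0}) (measurableSet_le measurable_const (by fun_prop))).symm

/-- The value at time one is normally distributed. -/
theorem exists_hasLaw_one [IsProbabilityMeasure P] (hY : ∀ u, Measurable (Y u))
    (hscaling : HasBrownianScaling Y P) (hincr : HasIndepForwardIncrements Y P)
    (hharness : HasHarnessProperty Y P) :
    ∃ (m : ℝ) (v : ℝ≥0), HasLaw (Y PosTime.one) (gaussianReal m v) P := by
  set a : PosTime := PosTime.one
  set b : PosTime := ⟨2, Set.mem_Ioi.2 two_pos⟩
  have hab : a < b := Subtype.mk_lt_mk.2 one_lt_two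
  refine exists_hasLaw_gaussianReal_of_bernstein (B := Y b - Y a) (hY a) ((hY b).sub (hY a)) ?_ ?_
  · exact IndepFun.symm (indep_of_indep_of_le_right (hincr.indep_sub hab.le)
      (measurable_pastSigma le_rfl).comap_le)
  rw [add_sub_cancel]
  refine IndepFun.symm ?_
  -- The shift by `2` keeps `s n < 1` at `n = 0` too.
  let s : ℕ → PosTime := fun n => ⟨1 / ((n : ℝ) + 2), Set.mem_Ioi.2 (by positivity)⟩
  have hs : Tendsto (fun n => (s n : ℝ)) atTop (𝓝 0) := by
    have := (tendsto_one_div_add_atTop_nhds_zero_nat (𝕜 := ℝ)).comp (tendsto_add_atTop_nat 1)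
    refine this.congr fun n => ?_
    simp only [Function.comp_apply, s]
    push_cast
    ring
  have hsa : ∀ n, s n < a := fun n => Subtype.mk_lt_mk.2 <| by
    rw [div_lt_one (by positivity)]
    have : (0 : ℝ) ≤ n := n.cast_nonneg
    linarith
  -- Along a subsequence `Y (s (k n)) → 0` almost surely; twice the bridge at time `1` then tends to
  -- `2 * Y 1 - Y 2`.
  obtain ⟨k, hk, hlim⟩ := (hscaling.tendstoInMeasure_zero hY hs).exists_seq_tendsto_ae
  have hbr : ∀ n, Measurable (bridge Y (s n) b a) := fun n =>
    (hY a).sub (((hY b).const_mul _).add ((hY (s n)).const_mul _))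
  refine indepFun_of_tendsto_ae (X := fun n ω => 2 * bridge Y (s (k n)) b a ω)
    (fun n => (hbr _).const_mul 2) ((hY a).sub ((hY b).sub (hY a))) (hY b)
    (fun n => (hharness.indepFun_bridge (hsa (k n)) hab).comp (measurable_const_mul 2)
      measurable_id) ?_
  filter_upwards [hlim] with ω hω
  have hsk := hs.comp hk.tendsto_atTop
  have h1 : Tendsto (fun n => ((1 : ℝ) - s (k n)) / (2 - s (k n))) atTop (𝓝 ((1 - 0) / (2 - 0))) :=
    (hsk.const_sub 1).div (hsk.const_sub 2) (by norm_num)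
  have h2 : Tendsto (fun n => ((2 : ℝ) - 1) / (2 - s (k n))) atTop (𝓝 ((2 - 1) / (2 - 0))) :=
    tendsto_const_nhds.div (hsk.const_sub 2) (by norm_num)
  have h3 := (((h1.mul_const (Y b ω)).add (h2.mul hω)).const_sub (Y a ω)).const_mul 2
  convert h3 using 2
  · rfl
  · simp only [Pi.sub_apply, Pi.zero_apply]
    ring

/-- All one-dimensional laws are centred normal, with variance proportional to time. -/
theorem exists_hasLaw_eval [IsProbabilityMeasure P] (hY : ∀ u, Measurable (Y u))
    (hcentred : IsCentred Y P) (hscaling : HasBrownianScaling Y P)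
    (hincr : HasIndepForwardIncrements Y P) (hharness : HasHarnessProperty Y P) :
    ∃ σ : ℝ, 0 ≤ σ ∧ ∀ u : PosTime,
      HasLaw (Y u) ((gaussianReal 0 u.toNNReal).map (σ * ·)) P := by
  obtain ⟨m, v, hm⟩ := exists_hasLaw_one hY hscaling hincr hharness
  -- Normality supplies the integrability on which centring is conditional.
  have hint : Integrable (Y PosTime.one) P := hm.hasGaussianLaw.integrable
  have hm0 : m = 0 := by
    rw [← hcentred _ hint, hm.integral_eq, integral_id_gaussianReal]
  subst hm0
  refine ⟨√v, Real.sqrt_nonneg _, fun u => ⟨(hY u).aemeasurable, ?_⟩⟩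
  rw [(hscaling.identDistrib_mul u).map_eq, (gaussianReal_const_mul hm _).map_eq,
    gaussianReal_map_const_mul]
  congr 1
  · simp
  · ext
    change √(u : ℝ) ^ 2 * (v : ℝ) = √(v : ℝ) ^ 2 * (u : ℝ)
    rw [Real.sq_sqrt (le_of_lt u.2), Real.sq_sqrt v.coe_nonneg, mul_comm]

end Harness

/-! ### From marginals and increments to pre-Brownian motion. -/

/-- The process `σ⁻¹ Y`, extended by zero to time zero. -/
noncomputable def normalizedProcess {Ω : Type*} (Y : PosTime → Ω → ℝ) (σ : ℝ) (t : ℝ≥0) (ω : Ω) :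
    ℝ :=
  if h : 0 < t then σ⁻¹ * Y ⟨t, Set.mem_Ioi.2 (NNReal.coe_pos.2 h)⟩ ω else 0

section Normalized

variable {Ω : Type*} [MeasurableSpace Ω] {P : Measure Ω} {Y : PosTime → Ω → ℝ} {σ : ℝ}

lemma measurable_normalizedProcess (hY : ∀ u, Measurable (Y u)) (t : ℝ≥0) :
    Measurable (normalizedProcess Y σ t) := by
  unfold normalizedProcess
  split_ifs with h
  · exact (hY _).const_mul _
  · exact measurable_const

omit [MeasurableSpace Ω] in
lemma normalizedProcess_toNNReal (u : PosTime) (ω : Ω) :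
    normalizedProcess Y σ u.toNNReal ω = σ⁻¹ * Y u ω :=
  dif_pos (show 0 < u.toNNReal from NNReal.coe_pos.1 (Set.mem_Ioi.1 u.2))

lemma HasIndepForwardIncrements.hasIndepIncrements_normalizedProcess [IsProbabilityMeasure P]
    (h : HasIndepForwardIncrements Y P) : HasIndepIncrements (normalizedProcess Y σ) P := by
  -- At time `0` the process is constant and the past is taken trivial, so independence of the
  -- increment from it is automatic.
  let 𝓖 : ℝ≥0 → MeasurableSpace Ω := fun u =>
    if h : 0 < u then pastSigma Y ⟨u, Set.mem_Ioi.2 (NNReal.coe_pos.2 h)⟩ else ⊥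
  have hX : ∀ {r u : ℝ≥0}, r ≤ u → Measurable[𝓖 u] (normalizedProcess Y σ r) := by
    intro r u hru
    unfold normalizedProcess
    split_ifs with hr
    · rw [show 𝓖 u = _ from dif_pos (hr.trans_le hru)]
      exact (measurable_pastSigma (Subtype.mk_le_mk.2 (NNReal.coe_le_coe.2 hru))).const_mul _
    · exact measurable_const
  refine hasIndepIncrements_iff_nat.2 fun t ht => iIndepFun_of_indep_past (fun i => 𝓖 (t i))
    (fun j i hji => (hX (ht hji)).sub (hX (ht hji.le))) fun i => ?_
  by_cases hi : 0 < t i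
  · have hi' : 0 < t (i + 1) := hi.trans_le (ht i.le_succ)
    simp only [𝓖, dif_pos hi, normalizedProcess, dif_pos hi', ← mul_sub]
    refine indep_of_indep_of_le_left (h.indep_sub (s := ⟨t (i + 1), Set.mem_Ioi.2
      (NNReal.coe_pos.2 hi')⟩) (Subtype.mk_le_mk.2 (NNReal.coe_le_coe.2 (ht i.le_succ)))) ?_
    exact Measurable.comap_le ((comap_measurable _).const_mul _)
  · simp only [𝓖, dif_neg hi]
    exact indep_bot_right _

lemma isPreBrownianReal_normalizedProcess [IsProbabilityMeasure P]
    (hincr : HasIndepForwardIncrements Y P) (hσ : σ ≠ 0)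
    (hlaw : ∀ u : PosTime, HasLaw (Y u) ((gaussianReal 0 u.toNNReal).map (σ * ·)) P) :
    IsPreBrownianReal (normalizedProcess Y σ) P := by
  refine HasIndepIncrements.isPreBrownianReal_of_hasLaw (fun t => ?_)
    hincr.hasIndepIncrements_normalizedProcess
  by_cases ht : 0 < t
  · have h1 : normalizedProcess Y σ t
        = (σ⁻¹ * ·) ∘ Y ⟨t, Set.mem_Ioi.2 (NNReal.coe_pos.2 ht)⟩ := by
      funext ω
      exact dif_pos ht
    have h2 := hlaw ⟨t, Set.mem_Ioi.2 (NNReal.coe_pos.2 ht)⟩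
    rw [h1]
    refine ⟨h2.aemeasurable.const_mul _, ?_⟩
    rw [← AEMeasurable.map_map_of_aemeasurable (by fun_prop) h2.aemeasurable, h2.map_eq,
      Measure.map_map (by fun_prop) (by fun_prop)]
    have h3 : ((σ⁻¹ * ·) ∘ (σ * ·) : ℝ → ℝ) = id := by
      funext x
      simp [hσ]
    rw [h3, Measure.map_id]
    rfl
  · have h0 : t = 0 := not_lt.1 ht |>.antisymm zero_le
    have h1 : normalizedProcess Y σ t = fun _ => 0 := by
      funext ω
      exact dif_neg ht
    subst h0
    rw [h1, gaussianReal_zero_var]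
    exact ⟨aemeasurable_const, by simp⟩

end Normalized

/-! ### Continuous modifications along dyadics. -/

/-- The largest dyadic of level `n` which is at most `t`. -/
noncomputable def dyadicFloor (n : ℕ) (t : ℝ≥0) : ℝ≥0 := (⌊2 ^ n * t⌋₊ : ℝ≥0) / 2 ^ n

lemma dyadicFloor_le (n : ℕ) (t : ℝ≥0) : dyadicFloor n t ≤ t := by
  rw [dyadicFloor, div_le_iff₀ (by positivity), mul_comm]
  exact Nat.floor_le zero_le

lemma dist_dyadicFloor_le (n : ℕ) (t : ℝ≥0) : dist (dyadicFloor n t) t ≤ (1 / 2) ^ n := by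
  have h1 : t ≤ dyadicFloor n t + (1 / 2) ^ n := by
    rw [dyadicFloor, one_div, inv_pow, ← one_div, ← add_div, le_div_iff₀ (by positivity), mul_comm]
    exact (Nat.lt_floor_add_one _).le
  have h2 : (t : ℝ) ≤ dyadicFloor n t + (1 / 2) ^ n := by exact_mod_cast h1
  have h3 : (dyadicFloor n t : ℝ) ≤ t := by exact_mod_cast dyadicFloor_le n t
  rw [NNReal.dist_eq, abs_sub_comm, abs_of_nonneg (by linarith)]
  linarith

section Deterministic

variable {x : ℝ≥0 → ℝ} {r : ℝ} {N n : ℕ}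

/-- Points at most one grid step apart have equal or adjacent dyadic floors. -/
lemma abs_sub_dyadicFloor_le (hr : 0 ≤ r)
    (h : ∀ k < N * 2 ^ n, |x ((k + 1 : ℕ) / 2 ^ n) - x ((k : ℕ) / 2 ^ n)| < r) {t u : ℝ≥0}
    (htu : t ≤ u) (hu : u ≤ t + (1 / 2) ^ n) (huN : u ≤ N) :
    |x (dyadicFloor n u) - x (dyadicFloor n t)| ≤ r := by
  have h1 : ⌊2 ^ n * t⌋₊ ≤ ⌊2 ^ n * u⌋₊ := Nat.floor_mono (by gcongr)
  have h2 : ⌊2 ^ n * u⌋₊ ≤ ⌊2 ^ n * t⌋₊ + 1 := by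
    rw [← Nat.floor_add_one zero_le]
    refine Nat.floor_mono ((mul_le_mul_right hu _).trans_eq ?_)
    rw [mul_add, ← mul_pow, mul_one_div_cancel two_ne_zero, one_pow]
  obtain h3 | h3 : ⌊2 ^ n * u⌋₊ = ⌊2 ^ n * t⌋₊ ∨ ⌊2 ^ n * u⌋₊ = ⌊2 ^ n * t⌋₊ + 1 := by omega
  · simpa [dyadicFloor, h3] using hr
  · have h4 : ⌊2 ^ n * u⌋₊ ≤ N * 2 ^ n := by
      refine Nat.floor_le_of_le ?_
      push_cast
      rw [mul_comm]
      gcongr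
    simp only [dyadicFloor, h3]
    exact (h _ (by omega)).le

/-- `⌊2 ^ n * t⌋₊` is half of `⌊2 ^ (n + 1) * t⌋₊`, rounded down; on the finer grid the two
approximations are equal or adjacent. -/
lemma abs_sub_dyadicFloor_succ_le (hr : 0 ≤ r)
    (h : ∀ k < N * 2 ^ (n + 1), |x ((k + 1 : ℕ) / 2 ^ (n + 1)) - x ((k : ℕ) / 2 ^ (n + 1))| < r)
    {t : ℝ≥0} (htN : t ≤ N) : |x (dyadicFloor n t) - x (dyadicFloor (n + 1) t)| ≤ r := by
  set F := ⌊2 ^ (n + 1) * t⌋₊ with hF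
  have h1 : ⌊2 ^ n * t⌋₊ = F / 2 := by
    rw [hF, ← Nat.floor_div_ofNat, pow_succ]
    congr 1
    field_simp
  have h2 : dyadicFloor n t = ((2 * (F / 2) : ℕ) : ℝ≥0) / 2 ^ (n + 1) := by
    rw [dyadicFloor, h1, pow_succ]
    push_cast
    field_simp
  have h3 : F ≤ N * 2 ^ (n + 1) := by
    refine Nat.floor_le_of_le ?_
    push_cast
    rw [mul_comm]
    gcongr
  rw [h2, abs_sub_comm, dyadicFloor, ← hF]
  obtain h4 | h4 : F = 2 * (F / 2) ∨ F = 2 * (F / 2) + 1 := by omega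
  · rw [← h4]
    simpa using hr
  · nth_rw 1 [h4]
    exact (h _ (by omega)).le

/-- A function whose dyadic increments decay geometrically, locally uniformly, agrees along the
dyadics with a continuous function. -/
lemma exists_continuous_tendsto_dyadicFloor (hr0 : 0 < r) (hr1 : r < 1)
    (h : ∀ N : ℕ, ∀ᶠ n : ℕ in atTop,
      ∀ k < N * 2 ^ n, |x ((k + 1 : ℕ) / 2 ^ n) - x ((k : ℕ) / 2 ^ n)| < r ^ n) :
    ∃ z : ℝ≥0 → ℝ, Continuous z ∧
      ∀ t, Tendsto (fun n => x (dyadicFloor n t)) atTop (𝓝 (z t)) := by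
  have hstep : ∀ N : ℕ, ∃ n₀ : ℕ, ∀ n, n₀ ≤ n →
      (∀ k < N * 2 ^ n, |x ((k + 1 : ℕ) / 2 ^ n) - x ((k : ℕ) / 2 ^ n)| < r ^ n) ∧
      ∀ t : ℝ≥0, t ≤ N → dist (x (dyadicFloor n t)) (x (dyadicFloor (n + 1) t)) ≤ r ^ n := by
    intro N
    obtain ⟨n₀, hn₀⟩ := eventually_atTop.1 (h N)
    refine ⟨n₀, fun n hn => ⟨hn₀ n hn, fun t ht => ?_⟩⟩
    refine (abs_sub_dyadicFloor_succ_le (by positivity) (hn₀ (n + 1) (by omega)) ht).trans ?_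
    exact pow_le_pow_of_le_one hr0.le hr1.le n.le_succ
  have hlim : ∀ t, ∃ y, Tendsto (fun n => x (dyadicFloor n t)) atTop (𝓝 y) := by
    intro t
    obtain ⟨N, hN⟩ := exists_nat_ge t
    obtain ⟨n₀, hn₀⟩ := hstep N
    obtain ⟨y, hy⟩ := cauchySeq_tendsto_of_complete (cauchySeq_of_le_geometric r (r ^ n₀) hr1
      (f := fun n => x (dyadicFloor (n + n₀) t)) fun n => by
        rw [← pow_add, add_comm n₀, show n + 1 + n₀ = n + n₀ + 1 by ring]
        exact (hn₀ (n + n₀) (by omega)).2 t hN)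
    exact ⟨y, (tendsto_add_atTop_iff_nat n₀).1 hy⟩
  choose z hz using hlim
  refine ⟨z, continuous_iff_continuousAt.2 fun t => ?_, hz⟩
  -- The extra `1` keeps a whole neighbourhood of `t` below `N`.
  obtain ⟨N, hN⟩ := exists_nat_ge (t + 1)
  obtain ⟨n₀, hn₀⟩ := hstep N
  have hclose : ∀ n, n₀ ≤ n → ∀ u : ℝ≥0, u ≤ N →
      dist (x (dyadicFloor n u)) (z u) ≤ r ^ n / (1 - r) := by
    intro n hn u hu
    have h1 := dist_le_of_le_geometric_of_tendsto r (r ^ n) hr1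
      (f := fun j => x (dyadicFloor (j + n) u)) (fun j => by
        rw [← pow_add, add_comm n, show j + 1 + n = j + n + 1 by ring]
        exact (hn₀ (j + n) (by omega)).2 u hu) ((tendsto_add_atTop_iff_nat n).2 (hz u)) 0
    simpa using h1
  have hinc : ∀ n, n₀ ≤ n → ∀ u : ℝ≥0, u ≤ N → ∀ v : ℝ≥0, v ≤ N → dist u v < (1 / 2) ^ n →
      dist (z u) (z v) ≤ r ^ n + 2 * (r ^ n / (1 - r)) := by
    intro n hn u hu v hv huv
    have h1 := hclose n hn u hu
    have h2 := hclose n hn v hv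
    have h3 : dist (x (dyadicFloor n u)) (x (dyadicFloor n v)) ≤ r ^ n := by
      rw [NNReal.dist_eq, abs_lt] at huv
      have h4 : u ≤ v + (1 / 2) ^ n := by
        rw [← NNReal.coe_le_coe]
        push_cast
        linarith
      have h5 : v ≤ u + (1 / 2) ^ n := by
        rw [← NNReal.coe_le_coe]
        push_cast
        linarith
      rcases le_total u v with huv' | huv'
      · rw [dist_comm]
        exact abs_sub_dyadicFloor_le (by positivity) (hn₀ n hn).1 huv' h5 hv
      · exact abs_sub_dyadicFloor_le (by positivity) (hn₀ n hn).1 huv' h4 hu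
    have h6 := dist_triangle4 (z u) (x (dyadicFloor n u)) (x (dyadicFloor n v)) (z v)
    rw [dist_comm (z u) (x _)] at h6
    linarith
  have hto : Tendsto (fun n : ℕ => r ^ n + 2 * (r ^ n / (1 - r))) atTop (𝓝 0) := by
    have := tendsto_pow_atTop_nhds_zero_of_lt_one hr0.le hr1
    simpa using this.add ((this.div_const (1 - r)).const_mul 2)
  refine Metric.continuousAt_iff.2 fun ε hε => ?_
  obtain ⟨n, hn, hnn⟩ := ((hto.eventually (gt_mem_nhds hε)).and (eventually_ge_atTop n₀)).exists
  refine ⟨(1 / 2) ^ n, by positivity, fun {u} hu => (hinc n hnn u ?_ t ?_ hu).trans_lt hn⟩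
  · rw [NNReal.dist_eq, abs_lt] at hu
    have h1 : ((1 : ℝ) / 2) ^ n ≤ 1 := pow_le_one₀ (by norm_num) (by norm_num)
    refine le_trans ?_ hN
    rw [← NNReal.coe_le_coe]
    push_cast
    linarith
  · exact le_self_add.trans hN

end Deterministic

section Modification

variable {Ω : Type*} [MeasurableSpace Ω] {P : Measure Ω} {X : ℝ≥0 → Ω → ℝ} {C : ℝ}

/-- A criterion of Kolmogorov–Chentsov type, in terms of the tails of the increments. -/
theorem exists_continuous_modification (hX : ∀ t, Measurable (X t)) (hC : 0 ≤ C)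
    (htail : ∀ s t : ℝ≥0, ∀ a : ℝ, 0 < a →
      P {ω | a ≤ |X s ω - X t ω|} ≤ ENNReal.ofReal (C * dist s t ^ 2 / a ^ 4)) :
    ∃ Z : ℝ≥0 → Ω → ℝ, (∀ t, Measurable (Z t)) ∧ (∀ t, Z t =ᵐ[P] X t) ∧
      ∀ ω, Continuous fun t => Z t ω := by
  -- The ratio is `2 * (1/4) / (9/10)^4 < 1`: `2 ^ n` intervals per unit length, squared mesh `4⁻ⁿ`,
  -- threshold `(9/10) ^ n`. Borel–Cantelli applies.
  have hsummable : ∀ K : ℝ, 0 ≤ K →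
      ∑' n : ℕ, ENNReal.ofReal (K * (10000 / 13122 : ℝ) ^ n) ≠ ⊤ := fun K hK =>
    ((summable_geometric_of_lt_one (by norm_num) (by norm_num)).mul_left K).tsum_ofReal_ne_top
  have hgood : ∀ᵐ ω ∂P, ∀ N : ℕ, ∀ᶠ n : ℕ in atTop, ∀ k < N * 2 ^ n,
      |X ((k + 1 : ℕ) / 2 ^ n) ω - X ((k : ℕ) / 2 ^ n) ω| < (9 / 10 : ℝ) ^ n := by
    refine ae_all_iff.2 fun N => ?_
    have h1 : ∀ n : ℕ, P (⋃ k ∈ Finset.range (N * 2 ^ n),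
        {ω | (9 / 10 : ℝ) ^ n ≤ |X ((k + 1 : ℕ) / 2 ^ n) ω - X ((k : ℕ) / 2 ^ n) ω|})
        ≤ ENNReal.ofReal (N * C * (10000 / 13122 : ℝ) ^ n) := by
      intro n
      refine (measure_biUnion_finset_le _ _).trans ?_
      refine (Finset.sum_le_card_nsmul _ _ (ENNReal.ofReal (C * (((1 / 2 : ℝ) ^ n) ^ 2)
        / ((9 / 10 : ℝ) ^ n) ^ 4)) fun k _ => ?_).trans ?_
      · refine (htail _ _ _ (by positivity)).trans_eq ?_
        congr 4
        rw [NNReal.dist_eq]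
        push_cast
        rw [← sub_div, add_sub_cancel_left, abs_of_nonneg (by positivity), one_div_pow]
      · rw [Finset.card_range, nsmul_eq_mul, ← ENNReal.ofReal_natCast,
          ← ENNReal.ofReal_mul (by positivity)]
        refine le_of_eq (congrArg _ ?_)
        push_cast
        have : (10000 / 13122 : ℝ) ^ n = 2 ^ n * ((1 / 2) ^ n) ^ 2 / ((9 / 10) ^ n) ^ 4 := by
          rw [← pow_mul', ← pow_mul', pow_mul, pow_mul, ← mul_pow, ← div_pow]
          norm_num
        rw [this]
        ring
    have h2 : ∑' n : ℕ, P (⋃ k ∈ Finset.range (N * 2 ^ n),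
        {ω | (9 / 10 : ℝ) ^ n ≤ |X ((k + 1 : ℕ) / 2 ^ n) ω - X ((k : ℕ) / 2 ^ n) ω|}) ≠ ⊤ :=
      ne_top_of_le_ne_top (hsummable (N * C) (by positivity)) (ENNReal.tsum_le_tsum h1)
    filter_upwards [ae_eventually_notMem h2] with ω hω
    filter_upwards [hω] with n hn k hk
    simp only [Set.mem_iUnion, Finset.mem_range, Set.mem_ofPred_eq, not_exists, not_le] at hn
    exact hn k hk
  -- At a fixed time the same bound identifies the limit along dyadics with `X t`.
  have hconv : ∀ t, ∀ᵐ ω ∂P, Tendsto (fun n => X (dyadicFloor n t) ω) atTop (𝓝 (X t ω)) := by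
    intro t
    have h1 : ∀ n : ℕ, P {ω | (9 / 10 : ℝ) ^ n ≤ |X (dyadicFloor n t) ω - X t ω|}
        ≤ ENNReal.ofReal (C * (10000 / 13122 : ℝ) ^ n) := by
      intro n
      refine (htail _ _ _ (by positivity)).trans (ENNReal.ofReal_le_ofReal ?_)
      have h2 : (1 / 4 : ℝ) ^ n / ((9 / 10) ^ n) ^ 4 ≤ (10000 / 13122) ^ n := by
        rw [← pow_mul', pow_mul, ← div_pow]
        refine pow_le_pow_left₀ (by norm_num) (by norm_num) n
      have h3 : dist (dyadicFloor n t) t ^ 2 ≤ (1 / 4) ^ n := by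
        refine (pow_le_pow_left₀ dist_nonneg (dist_dyadicFloor_le n t) 2).trans_eq ?_
        rw [← pow_mul', pow_mul]
        norm_num
      rw [mul_div_assoc]
      refine mul_le_mul_of_nonneg_left (le_trans ?_ h2) hC
      gcongr
    have h2 : ∑' n : ℕ, P {ω | (9 / 10 : ℝ) ^ n ≤ |X (dyadicFloor n t) ω - X t ω|} ≠ ⊤ :=
      ne_top_of_le_ne_top (hsummable C hC) (ENNReal.tsum_le_tsum h1)
    filter_upwards [ae_eventually_notMem h2] with ω hω
    refine tendsto_iff_dist_tendsto_zero.2 (squeeze_zero' (.of_forall fun _ => dist_nonneg) ?_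
      (tendsto_pow_atTop_nhds_zero_of_lt_one (r := (9 / 10 : ℝ)) (by norm_num) (by norm_num)))
    filter_upwards [hω] with n hn
    exact (not_le.1 hn).le
  obtain ⟨G, hGsub, hGmeas, hGnull⟩ := exists_measurable_superset_of_null (mem_ae_iff.1 hgood)
  have hG : ∀ ω, ω ∉ G → ∃ z : ℝ≥0 → ℝ, Continuous z ∧
      ∀ t, Tendsto (fun n => X (dyadicFloor n t) ω) atTop (𝓝 (z t)) := by
    intro ω hω
    refine exists_continuous_tendsto_dyadicFloor (x := fun t => X t ω) (r := 9 / 10)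
      (by norm_num) (by norm_num) ?_
    by_contra hcon
    exact hω (hGsub hcon)
  classical
  choose! z hz using hG
  refine ⟨fun t ω => if ω ∈ G then 0 else z ω t, fun t => ?_, fun t => ?_, fun ω => ?_⟩
  · refine measurable_of_tendsto_metrizable
      (f := fun n ω => if ω ∈ G then 0 else X (dyadicFloor n t) ω)
      (fun n => Measurable.ite hGmeas measurable_const (hX _)) (tendsto_pi_nhds.2 fun ω => ?_)
    by_cases hω : ω ∈ G
    · simp [hω]
    · simpa [hω] using (hz ω hω).2 t
  · have hGae : ∀ᵐ ω ∂P, ω ∉ G := measure_eq_zero_iff_ae_notMem.1 hGnull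
    filter_upwards [hGae, hconv t] with ω hω hlim
    rw [if_neg hω]
    exact tendsto_nhds_unique ((hz ω hω).2 t) hlim
  · by_cases hω : ω ∈ G
    · simpa [hω] using continuous_const
    · simpa [hω] using (hz ω hω).1

/-- Markov's inequality for the fourth power. Under scaling this moment is quadratic in the
variance, which gives the exponent `2` needed to beat the number of dyadic intervals. -/
lemma gaussianReal_tail_le (v : ℝ≥0) {a : ℝ} (ha : 0 < a) :
    gaussianReal 0 v {x | a ≤ |x|}
      ≤ ENNReal.ofReal ((∫ x, x ^ 4 ∂gaussianReal 0 1) * (v : ℝ) ^ 2 / a ^ 4) := by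
  have hmap : gaussianReal 0 v = (gaussianReal 0 1).map (√(v : ℝ) * ·) := by
    rw [gaussianReal_map_const_mul, mul_zero]
    congr 1
    ext
    change (v : ℝ) = √(v : ℝ) ^ 2 * 1
    rw [Real.sq_sqrt v.coe_nonneg, mul_one]
  have hint : Integrable (fun x : ℝ => x ^ 4) (gaussianReal 0 v) := by
    have h1 := (memLp_id_gaussianReal (μ := 0) (v := v) 4).integrable_norm_pow (p := 4) (by norm_num)
    refine h1.congr (.of_forall fun x => ?_)
    simp only [id_eq, Real.norm_eq_abs]
    exact Even.pow_abs (by decide) x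
  have hmom : ∫ x, x ^ 4 ∂gaussianReal 0 v = (∫ x, x ^ 4 ∂gaussianReal 0 1) * (v : ℝ) ^ 2 := by
    rw [hmap, integral_map (by fun_prop) (by fun_prop), ← integral_mul_const]
    refine integral_congr_ae (.of_forall fun x => ?_)
    change (√(v : ℝ) * x) ^ 4 = x ^ 4 * (v : ℝ) ^ 2
    rw [mul_pow, show √(v : ℝ) ^ 4 = (√(v : ℝ) ^ 2) ^ 2 by ring, Real.sq_sqrt v.coe_nonneg, mul_comm]
  have h1 := mul_meas_ge_le_integral_of_nonneg (μ := gaussianReal 0 v)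
    (.of_forall fun x : ℝ => by positivity) hint (a ^ 4)
  have h2 : {x : ℝ | a ≤ |x|} = {x : ℝ | a ^ 4 ≤ x ^ 4} := by
    ext x
    simp only [Set.mem_ofPred_eq]
    rw [← Even.pow_abs (show Even 4 by decide) x, pow_le_pow_iff_left₀ ha.le (abs_nonneg x)
      (by norm_num)]
  rw [h2, ← hmom, ENNReal.le_ofReal_iff_toReal_le (measure_ne_top _ _)
    (div_nonneg (integral_nonneg fun x => by positivity) (by positivity)), le_div_iff₀'
    (by positivity)]
  exact h1

/-- A pre-Brownian motion has a continuous modification. -/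
theorem exists_continuous_modification_of_isPreBrownianReal (hX : ∀ t, Measurable (X t))
    (h : IsPreBrownianReal X P) :
    ∃ Z : ℝ≥0 → Ω → ℝ, (∀ t, Measurable (Z t)) ∧ (∀ t, Z t =ᵐ[P] X t) ∧
      ∀ ω, Continuous fun t => Z t ω := by
  refine exists_continuous_modification (C := ∫ x, x ^ 4 ∂gaussianReal 0 1) hX
    (integral_nonneg fun x => by positivity) fun s t a ha => ?_
  have h1 := h.hasLaw_sub s t
  have h2 : P {ω | a ≤ |X s ω - X t ω|} = gaussianReal 0 (nndist s.1 t.1) {x | a ≤ |x|} := by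
    rw [← h1.map_eq, Measure.map_apply ((hX s).sub (hX t))
      (measurableSet_le measurable_const (by fun_prop))]
    rfl
  rw [h2]
  exact gaussianReal_tail_le _ ha

end Modification

/-! ### Isonormal processes and existence of Brownian motion. -/

section Isonormal

/-- This makes the characteristic function at a fixed `s` continuous on `L²`, so Gaussian identities
pass from finite sums to limits. -/
lemma norm_integral_cexp_sub_le {Ω : Type*} [MeasurableSpace Ω] {P : Measure Ω}
    [IsProbabilityMeasure P] (f g : Lp ℝ 2 P) (s : ℝ) :
    ‖∫ ω, Complex.exp (s * f ω * Complex.I) ∂P - ∫ ω, Complex.exp (s * g ω * Complex.I) ∂P‖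
      ≤ |s| * ‖f - g‖ := by
  have hf : AEMeasurable f P := (Lp.stronglyMeasurable f).measurable.aemeasurable
  have hg : AEMeasurable g P := (Lp.stronglyMeasurable g).measurable.aemeasurable
  have hint : ∀ h : Ω → ℝ, AEMeasurable h P →
      Integrable (fun ω => Complex.exp (s * h ω * Complex.I)) P := fun h hh => by
    refine Integrable.of_bound (C := 1) (by fun_prop) (.of_forall fun ω => ?_)
    rw [← Complex.ofReal_mul, Complex.norm_exp_ofReal_mul_I]
  have hexp : ∀ x y : ℝ, ‖Complex.exp (s * x * Complex.I) - Complex.exp (s * y * Complex.I)‖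
      ≤ |s| * ‖x - y‖ := by
    intro x y
    have h1 : Complex.exp (s * x * Complex.I) - Complex.exp (s * y * Complex.I)
        = Complex.exp ((s * y : ℝ) * Complex.I)
          * (Complex.exp (Complex.I * (s * (x - y) : ℝ)) - 1) := by
      rw [mul_sub, mul_one, ← Complex.exp_add]
      push_cast
      ring_nf
    rw [h1, norm_mul, Complex.norm_exp_ofReal_mul_I, one_mul]
    refine Real.norm_exp_I_mul_ofReal_sub_one_le.trans_eq ?_
    rw [norm_mul, Real.norm_eq_abs]
  have hL1 : ∫ ω, ‖(f - g) ω‖ ∂P ≤ ‖f - g‖ := by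
    rw [integral_norm_eq_lintegral_enorm (Lp.aestronglyMeasurable _), ← eLpNorm_one_eq_lintegral_enorm,
      Lp.norm_def]
    exact ENNReal.toReal_mono (Lp.eLpNorm_ne_top _)
      (eLpNorm_le_eLpNorm_of_exponent_le (by norm_num) (Lp.aestronglyMeasurable _))
  rw [← integral_sub (hint f hf) (hint g hg)]
  refine (norm_integral_le_integral_norm _).trans ?_
  refine le_trans ?_ (mul_le_mul_of_nonneg_left hL1 (abs_nonneg s))
  rw [← integral_const_mul]
  refine integral_mono_of_nonneg (.of_forall fun _ => norm_nonneg _)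
    (((Lp.memLp (f - g)).integrable (by norm_num)).norm.const_mul _) ?_
  filter_upwards [Lp.coeFn_sub f g] with ω hω
  rw [hω]
  exact hexp _ _

lemma coeFn_sum_smul {Ω ι : Type*} [MeasurableSpace Ω] {P : Measure Ω} (S : Finset ι) (a : ι → ℝ)
    (f : ι → Lp ℝ 2 P) :
    ∀ᵐ ω ∂P, (∑ i ∈ S, a i • f i : Lp ℝ 2 P) ω = ∑ i ∈ S, a i * f i ω := by
  classical
  induction S using Finset.induction_on with
  | empty =>
    filter_upwards [Lp.coeFn_zero ℝ 2 P] with ω h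
    simpa using h
  | insert i S hi ih =>
    rw [Finset.sum_insert hi]
    filter_upwards [ih, Lp.coeFn_add (a i • f i) (∑ j ∈ S, a j • f j),
      Lp.coeFn_smul (a i) (f i)] with ω h1 h2 h3
    rw [h2, Pi.add_apply, h1, h3, Pi.smul_apply, smul_eq_mul, Finset.sum_insert hi]

/-- An isonormal Gaussian process over a real Hilbert space. -/
theorem exists_isonormal (H : Type) [NormedAddCommGroup H] [InnerProductSpace ℝ H]
    [CompleteSpace H] :
    ∃ (Ω : Type) (_ : MeasurableSpace Ω) (P : Measure Ω) (_ : IsProbabilityMeasure P)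
      (W : H →ₗᵢ[ℝ] Lp ℝ 2 P), ∀ h, HasLaw (W h) (gaussianReal 0 (‖h‖₊ ^ 2)) P := by
  -- A Hilbert basis is sent to i.i.d. standard normals, which are orthonormal in `L²`; `W` is the
  -- isometry so determined.
  obtain ⟨w, b, -⟩ := exists_hilbertBasis ℝ H
  obtain ⟨Ω, mΩ, P, ξ, hξm, hξ, hind, hP⟩ := exists_iid w (gaussianReal 0 1)
  have hL2 : ∀ i, MemLp (ξ i) 2 P := fun i => (hξ i).hasGaussianLaw.memLp_two
  have hcov : ∀ i j, i ≠ j → ∫ ω, ξ i ω * ξ j ω ∂P = 0 := by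
    intro i j hij
    rw [(hind.indepFun hij).integral_fun_mul_eq_mul_integral (hξm i).aestronglyMeasurable
      (hξm j).aestronglyMeasurable, (hξ i).integral_eq, integral_id_gaussianReal, zero_mul]
  have hvar : ∀ i, ∫ ω, ξ i ω * ξ i ω ∂P = 1 := by
    intro i
    have h1 := (hξ i).variance_eq
    rw [variance_id_gaussianReal, variance_of_integral_eq_zero (hξm i).aemeasurable
      (by rw [(hξ i).integral_eq, integral_id_gaussianReal])] at h1
    simpa [pow_two] using h1
  let v : w → Lp ℝ 2 P := fun i => (hL2 i).toLp (ξ i)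
  have hinner : ∀ i j, inner ℝ (v i) (v j) = ∫ ω, ξ i ω * ξ j ω ∂P := by
    intro i j
    rw [L2.inner_def]
    refine integral_congr_ae ?_
    filter_upwards [(hL2 i).coeFn_toLp, (hL2 j).coeFn_toLp] with ω hi hj
    simp [v, hi, hj, mul_comm]
  have hv : Orthonormal ℝ v := by
    classical
    rw [orthonormal_iff_ite]
    intro i j
    rw [hinner]
    split_ifs with h
    · rw [h, hvar]
    · exact hcov i j h
  let W : H →ₗᵢ[ℝ] Lp ℝ 2 P :=
    hv.orthogonalFamily.linearIsometry.comp b.repr.toLinearIsometry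
  have hsum : ∀ h, HasSum (fun i => b.repr h i • v i) (W h) := fun h =>
    hv.orthogonalFamily.hasSum_linearIsometry (b.repr h)
  refine ⟨Ω, mΩ, P, hP, W, fun h => ?_⟩
  have hfin : ∀ (S : Finset w) (a : w → ℝ) (s : ℝ),
      ∫ ω, Complex.exp (s * (∑ i ∈ S, a i • v i : Lp ℝ 2 P) ω * Complex.I) ∂P
        = Complex.exp (-(‖∑ i ∈ S, a i • v i‖ ^ 2 * s ^ 2 / 2 : ℝ)) := by
    intro S a s
    have h1 : ∀ᵐ ω ∂P, (∑ i ∈ S, a i • v i : Lp ℝ 2 P) ω = ∑ i ∈ S, a i * ξ i ω := by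
      have h2 : ∀ᵐ ω ∂P, ∀ i : S, v i ω = ξ i ω := ae_all_iff.2 fun i => (hL2 i).coeFn_toLp
      filter_upwards [h2, coeFn_sum_smul S a v] with ω h3 h4
      rw [h4]
      exact Finset.sum_congr rfl fun i hi => by rw [h3 ⟨i, hi⟩]
    have h5 : ‖∑ i ∈ S, a i • v i‖ ^ 2 = ∑ i ∈ S, a i ^ 2 := by
      rw [← real_inner_self_eq_norm_sq, hv.inner_sum]
      simp [pow_two]
    have h6 : charFun (P.map fun ω => ∑ i ∈ S, a i * ξ i ω) s
        = ∏ i ∈ S, charFun (P.map fun ω => a i * ξ i ω) s := by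
      have h7 : iIndepFun (fun i ω => a i * ξ i ω) P :=
        hind.comp (fun i x => a i * x) fun i => by fun_prop
      rw [(h7.restrict S).charFun_map_fun_finsetSum_eq_prod
        (fun i _ => ((hξm i).const_mul _).aemeasurable), Finset.prod_apply]
    rw [charFun_apply_real, integral_map (by fun_prop) (by fun_prop)] at h6
    have h8 : ∀ i, charFun (P.map fun ω => a i * ξ i ω) s
        = Complex.exp (-(a i ^ 2 * s ^ 2 / 2 : ℝ)) := by
      intro i
      rw [charFun_map_mul_comp (hξm i).aemeasurable, (hξ i).map_eq, charFun_gaussianReal]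
      congr 1
      push_cast
      simp
      ring
    rw [integral_congr_ae (h1.mono fun ω hω => by rw [hω]), h6, h5]
    simp_rw [h8]
    rw [← Complex.exp_sum]
    congr 1
    push_cast
    rw [Finset.sum_neg_distrib, Finset.sum_mul, Finset.sum_div]
  have hlaw : ∀ s : ℝ, ∫ ω, Complex.exp (s * W h ω * Complex.I) ∂P
      = Complex.exp (-(‖W h‖ ^ 2 * s ^ 2 / 2 : ℝ)) := by
    intro s
    have hc : Continuous fun f : Lp ℝ 2 P => ∫ ω, Complex.exp (s * f ω * Complex.I) ∂P :=
      (LipschitzWith.of_dist_le_mul (K := ⟨|s|, abs_nonneg s⟩) fun f g => by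
        rw [dist_eq_norm, dist_eq_norm]
        exact norm_integral_cexp_sub_le f g s).continuous
    have hc' : Continuous fun f : Lp ℝ 2 P => Complex.exp (-(‖f‖ ^ 2 * s ^ 2 / 2 : ℝ)) := by
      fun_prop
    refine tendsto_nhds_unique ((hc.tendsto _).comp (hsum h)) ?_
    refine ((hc'.tendsto _).comp (hsum h)).congr fun S => ?_
    exact (hfin S (fun i => b.repr h i) s).symm
  have hm : AEMeasurable (W h) P := (Lp.stronglyMeasurable (W h)).measurable.aemeasurable
  have := Measure.isProbabilityMeasure_map hm
  refine ⟨hm, Measure.ext_of_charFun ?_⟩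
  funext s
  rw [charFun_apply_real, integral_map hm (by fun_prop), hlaw, charFun_gaussianReal]
  congr 1
  simp

end Isonormal

/-- A standard Brownian motion exists. -/
theorem exists_isBrownianReal :
    ∃ (Ω : Type) (_ : MeasurableSpace Ω) (P : Measure Ω) (B : ℝ≥0 → Ω → ℝ),
      IsProbabilityMeasure P ∧ (∀ t, Measurable (B t)) ∧ IsBrownianReal B P := by
  obtain ⟨Ω, mΩ, P, hP, W, hW⟩ := exists_isonormal (Lp ℝ 2 (volume : Measure ℝ))
  -- The indicators of `(0, t]` have inner products `min s t`, the Brownian covariance.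
  let e : ℝ≥0 → Lp ℝ 2 (volume : Measure ℝ) := fun t =>
    indicatorConstLp 2 (measurableSet_Ioc (a := 0) (b := (t : ℝ))) measure_Ioc_lt_top.ne 1
  have hinner : ∀ s t, inner ℝ (e s) (e t) = ((min s t : ℝ≥0) : ℝ) := by
    intro s t
    rw [L2.inner_indicatorConstLp_one_indicatorConstLp_one (hμs := measure_Ioc_lt_top.ne)
      (hμt := measure_Ioc_lt_top.ne), Set.Ioc_inter_Ioc,
      Real.volume_real_Ioc_of_le (by simp)]
    simp
  have hX : ∀ t, Measurable (W (e t)) := fun t => (Lp.stronglyMeasurable _).measurable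
  have hmean : ∀ t, ∫ ω, W (e t) ω ∂P = 0 := fun t => by
    rw [(hW (e t)).integral_eq, integral_id_gaussianReal]
  have hpre : IsPreBrownianReal (fun t => W (e t)) P := by
    refine IsGaussianProcess.isPreBrownianReal_of_covariance ⟨fun I => ⟨?_⟩⟩ hmean ?_
    · refine isGaussian_of_map_eq_gaussianReal fun L => ?_
      classical
      -- By linearity, a functional of a finite marginal is almost surely `W f` for a single vector
      -- `f`, hence normal.
      let f : Lp ℝ 2 (volume : Measure ℝ) := ∑ i : I, L (Pi.single i 1) • e i
      refine ⟨0, ‖f‖₊ ^ 2, ?_⟩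
      have hmeas : Measurable fun ω => I.restrict (fun t => W (e t) ω) :=
        measurable_pi_lambda _ fun i => hX i
      rw [Measure.map_map (by fun_prop) hmeas, ← (hW f).map_eq]
      refine Measure.map_congr ?_
      have h1 : W f = ∑ i : I, L (Pi.single i 1) • W (e i) := by
        simp [f, map_sum, map_smul]
      rw [h1]
      filter_upwards [coeFn_sum_smul Finset.univ (fun i : I => L (Pi.single i 1))
        fun i : I => W (e i)] with ω hω
      rw [hω, Function.comp_apply]
      conv_lhs => rw [← Finset.univ_sum_single (I.restrict fun t => W (e t) ω), map_sum]
      refine Finset.sum_congr rfl fun i _ => ?_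
      rw [mul_comm, ← smul_eq_mul, ← map_smul, ← Pi.single_smul, smul_eq_mul, mul_one]
      rfl
    · intro s t hst
      have hL2 : ∀ t, MemLp (W (e t)) 2 P := fun t => Lp.memLp _
      rw [covariance_eq_sub (hL2 s) (hL2 t), hmean, zero_mul, sub_zero]
      have h1 := W.inner_map_map (e s) (e t)
      rw [hinner, min_eq_left hst, L2.inner_def] at h1
      rw [← h1]
      refine integral_congr_ae (.of_forall fun ω => ?_)
      simp [mul_comm]
  obtain ⟨B, hB, hBX, hcont⟩ := exists_continuous_modification_of_isPreBrownianReal hX hpre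
  exact ⟨Ω, mΩ, P, B, hP, hB, ⟨hpre.congr fun t => (hBX t).symm, .of_forall hcont⟩⟩

/-! ### Uniqueness in law and conclusion. -/

/-- Two pre-Brownian motions have the same law. -/
lemma identDistrib_of_isPreBrownianReal {Ω Ω' : Type*} [MeasurableSpace Ω] [MeasurableSpace Ω']
    {P : Measure Ω} {P' : Measure Ω'} {X : ℝ≥0 → Ω → ℝ} {X' : ℝ≥0 → Ω' → ℝ}
    (hm : ∀ t, Measurable (X t)) (hm' : ∀ t, Measurable (X' t))
    (hX : IsPreBrownianReal X P) (hX' : IsPreBrownianReal X' P') :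
    IdentDistrib (fun ω t => X t ω) (fun ω t => X' t ω) P P' := by
  have hmX : Measurable fun ω t => X t ω := measurable_pi_lambda _ hm
  have hmX' : Measurable fun ω t => X' t ω := measurable_pi_lambda _ hm'
  refine ⟨hmX.aemeasurable, hmX'.aemeasurable, ?_⟩
  -- Both laws are projective limits of the same finite-dimensional Gaussian family, and such a
  -- limit is unique.
  have h1 := isProjectiveLimit_map (P := P) hmX.aemeasurable
  have h2 := isProjectiveLimit_map (P := P') hmX'.aemeasurable
  simp_rw [fun I => (hX.hasLaw I).map_eq] at h1
  simp_rw [fun I => (hX'.hasLaw I).map_eq] at h2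
  exact h1.unique h2

theorem mainTheorem3 {Ω : Type*} [MeasurableSpace Ω] (P : Measure Ω) [IsProbabilityMeasure P]
    (Y : PosTime → Ω → ℝ) (hmeas : ∀ u, Measurable (Y u))
    (hcentred : IsCentred Y P)
    (hcont : IsStochasticallyContinuous Y P)
    (ξ : ℝ) (hξ : 0 < ξ) (hmoment : ∀ u, Integrable (fun ω => |Y u ω| ^ ξ) P)
    (hscaling : HasBrownianScaling Y P)
    (hincr : HasIndepForwardIncrements Y P)
    (hharness : HasHarnessProperty Y P) :
    ∃ σ : ℝ, 0 ≤ σ ∧ ∃ Z : PosTime → Ω → ℝ,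
      (∀ u, Measurable (Z u)) ∧
      (∀ u, Z u =ᵐ[P] Y u) ∧
      (∀ ω, Continuous (fun u => Z u ω)) ∧
      ∃ (Ω' : Type) (_ : MeasurableSpace Ω') (P' : Measure Ω') (B : ℝ≥0 → Ω' → ℝ),
        IsProbabilityMeasure P' ∧ IsBrownianReal B P' ∧
        IdentDistrib (fun ω (u : PosTime) => Z u ω)
          (fun ω' (u : PosTime) => σ * B u.toNNReal ω') P P' := by
  obtain ⟨σ, hσ, hlaw⟩ := exists_hasLaw_eval hmeas hcentred hscaling hincr hharness
  obtain ⟨Ω', mΩ', P', B, hP', hBm, hB⟩ := exists_isBrownianReal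
  refine ⟨σ, hσ, ?_⟩
  -- If `σ = 0`, dividing by `σ` is impossible, but each `Y u` vanishes almost surely and the zero
  -- process serves.
  obtain rfl | hσ0 := eq_or_ne σ 0
  · refine ⟨fun _ _ => 0, fun _ => measurable_const, fun u => ?_, fun _ => continuous_const,
      Ω', mΩ', P', B, hP', hB, ?_⟩
    · have h1 := hlaw u
      simp only [zero_mul, Measure.map_const, measure_univ, one_smul] at h1
      filter_upwards [h1.ae_eq_of_dirac] with ω hω
      exact hω.symm
    · simp only [zero_mul]
      exact ⟨aemeasurable_const, aemeasurable_const, by simp [Measure.map_const]⟩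
  · have hpre := isPreBrownianReal_normalizedProcess hincr hσ0 hlaw
    obtain ⟨X, hXm, hXY, hXc⟩ := exists_continuous_modification_of_isPreBrownianReal
      (measurable_normalizedProcess hmeas) hpre
    have hto : Continuous PosTime.toNNReal := continuous_subtype_val.subtype_mk _
    refine ⟨fun u ω => σ * X u.toNNReal ω, fun u => (hXm _).const_mul _, fun u => ?_,
      fun ω => continuous_const.mul ((hXc ω).comp hto), Ω', mΩ', P', B, hP', hB, ?_⟩
    · filter_upwards [hXY u.toNNReal] with ω hω
      rw [hω, normalizedProcess_toNNReal, mul_inv_cancel_left₀ hσ0]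
    · exact (identDistrib_of_isPreBrownianReal hXm hBm (hpre.congr fun t => (hXY t).symm)
        hB.toIsPreBrownianReal).comp
        (u := fun (x : ℝ≥0 → ℝ) (u : PosTime) => σ * x u.toNNReal) (by fun_prop)
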